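/- A unit square is a closed solid square of edge length $1$, in any position in the Euclidean plane. For $n\ge 1$ let $S(n)$ be the largest edge length of a closed square that can be covered by $n$ unit squares, and let $S_{\mathrm{bd}}(n)$ be the largest edge length of a square whose boundary can be covered by $n$ unit squares. Let $\varphi=\frac{1+\sqrt5}{2}$. Then $$S_{\mathrm{bd}}(2)=S(2)=1\qquad\text{and}\qquad S_{\mathrm{bd}}(3)=S(3)=\sqrt{\varphi}$$ (in particular, all these maxima are attained). Furthermore, let $\mathcal F$ be a family of $n$ unit squares covering the boundary of a square $S$ of edge length $S_{\mathrm{bd}}(n)$. - If $n=2$, then at least one element of $\mathcal F$ is a translate of $S$. - If $n=3$, then, up to a congruence of the plane, $S=[0,\sqrt\varphi]^2$ and the three elements of $\mathcal F$ are, in some order, the following squares $S_1,S_2,S_3$. The squares $S_1$ and $S_2$ are the images of $[0,1]^2$ under the rotations about the origin by the angles $-\alpha$ and $\alpha$, where $\alpha=\arccos\frac{1}{\sqrt\varphi}$, and $S_3=[\sqrt\varphi-1,\sqrt\varphi]^2$ is the homothetic copy of $S$ of edge length $1$ whose homothety center is the vertex $(\sqrt\varphi,\sqrt\varphi)$ of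 $S$. -/

import Mathlib

/-- The Euclidean plane. -/
abbrev Plane : Type := EuclideanSpace ℝ (Fin 2)

/-- The closed axis-parallel square `[0, a] × [0, a]`. -/
def stdSquare (a : ℝ) : Set Plane := {x | ∀ i, x i ∈ Set.Icc 0 a}

/-- `Q` is a (closed, solid) square of edge length `a > 0` in the plane, in any position:
a congruent copy of `[0, a] × [0, a]`. -/
def IsSquareOfEdge (a : ℝ) (Q : Set Plane) : Prop :=
  0 < a ∧ ∃ g : Plane ≃ᵢ Plane, Q = g '' stdSquare a

/-- The edge lengths of the squares that can be covered with `n` unit squares. -/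
def coverableEdges (n : ℕ) : Set ℝ :=
  {a | ∃ (S : Set Plane) (F : Fin n → Set Plane),
    IsSquareOfEdge a S ∧ (∀ i, IsSquareOfEdge 1 (F i)) ∧ S ⊆ ⋃ i, F i}

/-- The edge lengths of the squares whose boundary can be covered with `n` unit squares. -/
def bdCoverableEdges (n : ℕ) : Set ℝ :=
  {a | ∃ (S : Set Plane) (F : Fin n → Set Plane),
    IsSquareOfEdge a S ∧ (∀ i, IsSquareOfEdge 1 (F i)) ∧ frontier S ⊆ ⋃ i, F i}

/-- `s` is the value `S(n)`: the largest edge length of a square that can be covered with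
`n` unit squares. -/
def IsS (n : ℕ) (s : ℝ) : Prop := IsGreatest (coverableEdges n) s

/-- `s` is the value `S_bd(n)`: the largest edge length of a square whose boundary can be
covered with `n` unit squares. -/
def IsSbd (n : ℕ) (s : ℝ) : Prop := IsGreatest (bdCoverableEdges n) s

/-- Counterclockwise rotation about the origin by the angle `θ`. -/
noncomputable def rot (θ : ℝ) (x : Plane) : Plane :=
  !₂[Real.cos θ * x 0 - Real.sin θ * x 1, Real.sin θ * x 0 + Real.cos θ * x 1]

/-- The edge length `√φ`, where `φ` is the golden ratio. -/
noncomputable def sqrtPhi : ℝ := Real.sqrt Real.goldenRatio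

/-- The three unit squares of the extremal configuration for `S = [0, √φ] × [0, √φ]`:
with `α = arccos (1 / √φ)`, the rotated copies of `[0, 1] × [0, 1]` by `-α` and by `α` about
the vertex `(0, 0)` of `S`, and the homothetic copy of `S` of edge length `1` with the
vertex `(√φ, √φ)` of `S` as homothety center. -/
noncomputable def extremalSquares : Fin 3 → Set Plane :=
  ![rot (-Real.arccos (1 / sqrtPhi)) '' stdSquare 1,
    rot (Real.arccos (1 / sqrtPhi)) '' stdSquare 1,
    AffineMap.homothety (!₂[sqrtPhi, sqrtPhi] : Plane) (1 / sqrtPhi) '' stdSquare sqrtPhi]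

/-! ### Real inequalities -/

/-! Put S = [0, a]². A unit square has edge directions (c, s) and (-s, c) with c, s ≥ 0 on the unit
circle, and two of its points differ by at most 1 along each. All metric input consists of such
width inequalities.

Two squares, a ≥ 1: if one holds a diagonal, then (c + s)a ≤ 1 and a = 1. Otherwise they contain
opposite edges and meet on the two other edges. One of them then reaches total height at least a
there, and `eq_one_of_trapezoid` forces a = 1 and an axis-parallel square.

Three squares, a ≥ r = √φ: a diagonal is longer than √2, so two adjacent corners share a square A,
say on the bottom edge. A reaches at most a - 1 up the sides (`height_le`), and the top corners lie
in different squares B and C (`not_opposite_edges`). Let A and B meet at (0, l), A and C at (a, t),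
B and C at (p, a); by reflection c ≤ s for A. Tilting A to gain height l on the left costs at least
0.6 l on the right (`heights_le`). B and C contain right triangles with vertical legs a - l and a -
t, which bounds their top legs (`leg_le`). B gains at most 2l, while C, whose vertical leg starts
from the critical value 1, loses at least 2.1 l. Hence a ≤ r - l/10, so a = r and l = 0, and
equality fixes all three squares. -/

lemma one_le_add_of_sq_add_sq {c s : ℝ} (hc : 0 ≤ c) (hs : 0 ≤ s) (h : c ^ 2 + s ^ 2 = 1) :
    1 ≤ c + s := by
  nlinarith [mul_nonneg hc hs]

lemma le_one_of_sq_add_sq {c s : ℝ} (h : c ^ 2 + s ^ 2 = 1) : c ≤ 1 := by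
  nlinarith [sq_nonneg s, sq_nonneg (c - 1)]

/-- Weighting the three inequalities by c, s and cs gives a(1 + cs) ≤ c + s = 1 + cs - (1 - c)(1 -
s). Here a is the base of a trapezoid in the unit square and l, t are its parallel sides. -/
lemma eq_one_of_trapezoid {a c s l t : ℝ} (ha : 1 ≤ a) (hc : 0 ≤ c) (hs : 0 ≤ s)
    (h : c ^ 2 + s ^ 2 = 1) (h1 : c * a + s * t ≤ 1) (h2 : c * l + s * a ≤ 1)
    (h3 : a ≤ l + t) : a = 1 ∧ c * s = 0 := by
  have hc1 := le_one_of_sq_add_sq h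
  have hs1 : s ≤ 1 := le_one_of_sq_add_sq (by linarith : s ^ 2 + c ^ 2 = 1)
  have hcs := mul_nonneg hc hs
  have e1 := mul_le_mul_of_nonneg_left h1 hc
  have e2 := mul_le_mul_of_nonneg_left h2 hs
  have e3 := mul_le_mul_of_nonneg_left h3 hcs
  have e4 : a * (1 + c * s) ≤ c + s := by nlinarith
  have e5 := mul_nonneg (sub_nonneg.2 hc1) (sub_nonneg.2 hs1)
  have ha1 : a = 1 := by nlinarith
  refine ⟨ha1, ?_⟩
  subst ha1
  have e6 : (1 - c) * (1 - s) = 0 := le_antisymm (by nlinarith) e5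
  rcases mul_eq_zero.1 e6 with h | h
  · have : s ^ 2 = 0 := by nlinarith
    simp [pow_eq_zero_iff] at this; simp [this]
  · have : c ^ 2 = 0 := by nlinarith
    simp [pow_eq_zero_iff] at this; simp [this]

/-- A unit square that contains a right triangle with one leg `b ≥ 1` has the other leg bounded
by the smaller root of `(b - P)² = b² (b² - 1)`. -/
lemma leg_le {b c s p P : ℝ} (hb : 1 ≤ b) (hc : 0 ≤ c) (hs : 0 ≤ s) (h : c ^ 2 + s ^ 2 = 1)
    (h1 : b * c ≤ 1) (h2 : p * s ≤ 1) (h3 : b * s + p * c ≤ 1) (hP : P ≤ b)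
    (h4 : (b - P) ^ 2 ≤ b ^ 2 * (b ^ 2 - 1)) : p ≤ P := by
  rcases hc.eq_or_lt with rfl | hc0
  · have hs1 : s = 1 := by nlinarith
    subst hs1
    have : b = 1 := by linarith
    subst this
    have : P = 1 := by nlinarith
    linarith
  by_contra! hp
  have h5 : b * s + P * c < 1 := by nlinarith
  have h6 : 0 < 1 - P * c := by nlinarith [mul_nonneg (by linarith : (0:ℝ) ≤ b) hs]
  have h7 : b ^ 2 * s ^ 2 < (1 - P * c) ^ 2 := by
    have := mul_nonneg (by linarith : (0:ℝ) ≤ b) hs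
    nlinarith
  have h8 : b ^ 2 * (1 - c ^ 2) < (1 - P * c) ^ 2 := by
    rw [(by linarith : 1 - c ^ 2 = s ^ 2)]; linarith
  -- the difference is concave in `c`, nonnegative at `c = 0` and at `c = 1 / b`
  have h9 : b ^ 2 * (b ^ 2 * (1 - c ^ 2) - (1 - P * c) ^ 2)
      = (1 - b * c) * (b ^ 2 * (b ^ 2 - 1) + b * c * (b ^ 2 + P ^ 2))
        + (b * c) * (b ^ 2 * (b ^ 2 - 1) - (b - P) ^ 2) := by ring
  have hb0 : (0:ℝ) < b := by linarith
  have : 0 ≤ (1 - b * c) * (b ^ 2 * (b ^ 2 - 1) + b * c * (b ^ 2 + P ^ 2)) := by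
    apply mul_nonneg (by linarith)
    have : 0 ≤ b ^ 2 - 1 := by nlinarith
    positivity
  have : 0 ≤ (b * c) * (b ^ 2 * (b ^ 2 - 1) - (b - P) ^ 2) :=
    mul_nonneg (by positivity) (by linarith)
  nlinarith [pow_pos hb0 2]

lemma sqrtPhi_pos : 0 < sqrtPhi := Real.sqrt_pos.2 Real.goldenRatio_pos

lemma sqrtPhi_pow_four : sqrtPhi ^ 4 = sqrtPhi ^ 2 + 1 := by
  have h : sqrtPhi ^ 2 = Real.goldenRatio := Real.sq_sqrt Real.goldenRatio_pos.le
  have := Real.goldenRatio_sq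
  rw [← h] at this
  linarith [this, (by ring : sqrtPhi ^ 4 = (sqrtPhi ^ 2) ^ 2)]

lemma lt_sqrtPhi : 1.272 < sqrtPhi := by
  by_contra! h
  have h0 := sqrtPhi_pos
  have h1 := sqrtPhi_pow_four
  have : sqrtPhi ^ 2 ≤ 1.272 ^ 2 := by gcongr
  nlinarith

lemma sqrtPhi_lt : sqrtPhi < 1.2721 := by
  by_contra! h
  have h0 := sqrtPhi_pos
  have h1 := sqrtPhi_pow_four
  have : 1.2721 ^ 2 ≤ sqrtPhi ^ 2 := by gcongr
  nlinarith

/-- A unit square containing a segment of length `a ≥ √φ` reaches at most `a - 1` above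
either of its endpoints. -/
lemma height_le {a c s h : ℝ} (ha : sqrtPhi ≤ a) (hc : 0 ≤ c) (hs : 0 ≤ s)
    (hcs : c ^ 2 + s ^ 2 = 1) (h1 : a * c ≤ 1) (h2 : a * s + h * c ≤ 1) : h ≤ a - 1 := by
  have hr := lt_sqrtPhi
  have h4 := sqrtPhi_pow_four
  have hs1 : s ≤ 1 := le_one_of_sq_add_sq (by linarith : s ^ 2 + c ^ 2 = 1)
  by_contra! hh
  -- This is where the golden ratio enters: √φ is the positive root of x²(x² - 1) = 1.
  have h3 : 1 ≤ a ^ 2 * (a ^ 2 - 1) := by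
    have h2 : sqrtPhi ^ 2 ≤ a ^ 2 := by gcongr
    have := mul_le_mul h2 (sub_le_sub_right h2 1) (by nlinarith) (sq_nonneg a)
    linarith [(by ring : sqrtPhi ^ 4 = sqrtPhi ^ 2 * (sqrtPhi ^ 2 - 1) + sqrtPhi ^ 2)]
  have hc0 : 0 < c := by
    rcases hc.eq_or_lt with rfl | hc0
    · have : s = 1 := by nlinarith
      subst this; linarith
    · exact hc0
  have h5 : a * s + (a - 1) * c ≤ 1 := by nlinarith
  have h5' : a * s + (a - 1) * c < 1 := by nlinarith
  have h6 : (a * s) ^ 2 < (1 - (a - 1) * c) ^ 2 := by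
    have := mul_nonneg (by linarith : (0:ℝ) ≤ a) hs
    nlinarith
  have h9 : a ^ 2 * ((a * s) ^ 2 - (1 - (a - 1) * c) ^ 2)
      = (1 - a * c) * (a ^ 2 * (a ^ 2 - 1) + a * c * (a ^ 2 + (a - 1) ^ 2))
        + (a * c) * (a ^ 2 * (a ^ 2 - 1) - 1) := by
    rw [mul_pow, (by linarith : s ^ 2 = 1 - c ^ 2)]; ring
  have ha0 : (0:ℝ) < a := by linarith
  have : 0 ≤ (1 - a * c) * (a ^ 2 * (a ^ 2 - 1) + a * c * (a ^ 2 + (a - 1) ^ 2)) := by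
    apply mul_nonneg (by linarith)
    have : 0 ≤ a ^ 2 - 1 := by nlinarith
    positivity
  have : 0 ≤ (a * c) * (a ^ 2 * (a ^ 2 - 1) - 1) := mul_nonneg (by positivity) (by linarith)
  nlinarith [pow_pos ha0 2]

/-- The equality case of `height_le` for the edge length `√φ`. -/
lemma eq_of_height_eq {c s : ℝ} (hc : 0 ≤ c) (hs : 0 ≤ s) (hcs : c ^ 2 + s ^ 2 = 1)
    (h1 : sqrtPhi * c ≤ 1) (h2 : sqrtPhi * s + (sqrtPhi - 1) * c ≤ 1) :
    c = 1 / sqrtPhi ∧ s = 1 / sqrtPhi ^ 2 := by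
  have hr := lt_sqrtPhi
  have hr0 := sqrtPhi_pos
  have h4 := sqrtPhi_pow_four
  set r := sqrtPhi
  have h6 : (r * s) ^ 2 ≤ (1 - (r - 1) * c) ^ 2 := by
    have := mul_nonneg hr0.le hs
    gcongr
    linarith
  -- Since r²(r² - 1) = 1, the endpoint term at c = 1/r vanishes, and the remaining factor 1 - rc
  -- must be zero.
  have h9 : r ^ 2 * ((r * s) ^ 2 - (1 - (r - 1) * c) ^ 2)
      = (1 - r * c) * (1 + r * c * (r ^ 2 + (r - 1) ^ 2)) := by
    rw [mul_pow, (by linarith : s ^ 2 = 1 - c ^ 2)]; linear_combination h4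
  have h10 : r * c = 1 := by
    by_contra hne
    have : 0 < 1 - r * c := sub_pos.2 (lt_of_le_of_ne h1 hne)
    have : 0 < (1 - r * c) * (1 + r * c * (r ^ 2 + (r - 1) ^ 2)) := by positivity
    nlinarith [pow_pos hr0 2]
  have hc' : c = 1 / r := by field_simp; linarith
  refine ⟨hc', ?_⟩
  have : s ^ 2 = (1 / r ^ 2) ^ 2 := by
    have : s ^ 2 = 1 - (1 / r) ^ 2 := by rw [← hc']; linarith
    rw [this]; field_simp; linarith
  exact (pow_left_inj₀ hs (by positivity) two_ne_zero).1 this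

/-- A unit square containing an edge of length `√φ` covers initial pieces of lengths `l` and `t`
of the two adjacent edges; this bounds them jointly. -/
lemma heights_le {c s l t : ℝ} (hc : 0 ≤ c) (hs : 0 ≤ s) (hcs : c ^ 2 + s ^ 2 = 1)
    (hle : c ≤ s) (hl : 0 ≤ l) (a1 : sqrtPhi * s + l * c ≤ 1) (a2 : sqrtPhi * c + t * s ≤ 1) :
    l ≤ 0.153 ∧ t ≤ sqrtPhi - 1 - 0.6 * l := by
  have hr := lt_sqrtPhi
  have hr' := sqrtPhi_lt
  have hr0 := sqrtPhi_pos
  have h4 := sqrtPhi_pow_four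
  set r := sqrtPhi
  have hrs : r * s ≤ 1 := by nlinarith [mul_nonneg hl hc]
  have hcr : 1 ≤ r ^ 2 * c := by
    have : 1 ^ 2 ≤ (r ^ 2 * c) ^ 2 := by
      have : (r * s) ^ 2 ≤ 1 := by have := mul_nonneg hr0.le hs; nlinarith
      have : (r ^ 2 * c) ^ 2 = r ^ 4 - r ^ 2 * (r * s) ^ 2 := by
        rw [mul_pow, (by linarith : c ^ 2 = 1 - s ^ 2)]; ring
      nlinarith [sq_nonneg r]
    exact (pow_le_pow_iff_left₀ (by norm_num) (by positivity) two_ne_zero).1 this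
  have hc617 : 0.617 ≤ c := by nlinarith
  have hs0 : 0 < s := by linarith
  -- The bound (1 - rs)/c on l is largest at c = s, where it is √2 - r ≈ 0.142.
  have hl153 : l ≤ 0.153 := by
    have hs' : s ≤ 0.7863 := by nlinarith
    have : 1.403 ≤ c + s := by nlinarith
    by_contra! h
    nlinarith [mul_nonneg (sub_nonneg.2 hle) (by linarith : (0:ℝ) ≤ r - 0.153)]
  refine ⟨hl153, ?_⟩
  -- Relates the two slacks 1 - rs and r²c - 1, which vanish together at the extremal tilt.
  have hw : (1 - r * s) * (1 + r * s) * r ^ 2 = (r ^ 2 * c - 1) * (r ^ 2 * c + 1) := by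
    have : s ^ 2 = 1 - c ^ 2 := by linarith
    linear_combination -r ^ 4 * this - h4
  have hW : 0 ≤ 1 - r * s := by linarith
  have hcs0 : 0 < r * c * s := by positivity
  have e1 : ((r - 1) * c + 0.6 * (r * s)) * (r ^ 2 * c + 1) ≤ c * (1 + r * s) * r ^ 2 := by
    have hc1 := le_one_of_sq_add_sq hcs
    have f1 : 2 * ((r - 1) * c + 0.6 * (r * s)) ≤ 1 + r * s := by
      have := mul_le_mul (by linarith : r - 1 ≤ 0.3) hc1 hc (by norm_num)
      linarith
    have f2 : 0 ≤ (r - 1) * c + 0.6 * (r * s) :=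
      add_nonneg (mul_nonneg (by linarith) hc) (by positivity)
    calc ((r - 1) * c + 0.6 * (r * s)) * (r ^ 2 * c + 1)
        ≤ ((r - 1) * c + 0.6 * (r * s)) * (2 * (r ^ 2 * c)) := by gcongr; linarith
      _ = 2 * ((r - 1) * c + 0.6 * (r * s)) * (r ^ 2 * c) := by ring
      _ ≤ (1 + r * s) * (r ^ 2 * c) := by gcongr
      _ = _ := by ring
  -- What is left of the goal, multiplied by rcs, after bounding l by `a1` and t by `a2`.
  have e2 : ((r - 1) * c + 0.6 * (r * s)) * (1 - r * s) ≤ c * (r ^ 2 * c - 1) := by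
    have := mul_le_mul_of_nonneg_right e1 hW
    have f3 : 0 < r ^ 2 * c + 1 := by positivity
    refine le_of_mul_le_mul_right ?_ f3
    linear_combination this + c * hw
  have g1 := mul_le_mul_of_nonneg_left a1 (by positivity : 0 ≤ r * s)
  have g2 := mul_le_mul_of_nonneg_left a2 (by positivity : 0 ≤ r * c)
  refine le_of_mul_le_mul_left ?_ hcs0
  linear_combination g2 + 0.6 * g1 + e2

/-- The inequality behind the extremality of `√φ`. -/
lemma extremal_inequality {c s l t c₁ s₁ c₂ s₂ p q : ℝ}
    (hc : 0 ≤ c) (hs : 0 ≤ s) (hcs : c ^ 2 + s ^ 2 = 1)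
    (hc₁ : 0 ≤ c₁) (hs₁ : 0 ≤ s₁) (hcs₁ : c₁ ^ 2 + s₁ ^ 2 = 1)
    (hc₂ : 0 ≤ c₂) (hs₂ : 0 ≤ s₂) (hcs₂ : c₂ ^ 2 + s₂ ^ 2 = 1)
    (hle : c ≤ s) (hl : 0 ≤ l)
    (a1 : sqrtPhi * s + l * c ≤ 1) (a2 : sqrtPhi * c + t * s ≤ 1)
    (b1 : (sqrtPhi - l) * c₁ ≤ 1) (b2 : p * s₁ ≤ 1) (b3 : (sqrtPhi - l) * s₁ + p * c₁ ≤ 1)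
    (d1 : (sqrtPhi - t) * c₂ ≤ 1) (d2 : q * s₂ ≤ 1) (d3 : (sqrtPhi - t) * s₂ + q * c₂ ≤ 1) :
    p + q ≤ sqrtPhi - l / 10 ∧ p ≤ sqrtPhi - 1 + 2 * l ∧ q ≤ 1 - 2.1 * l := by
  obtain ⟨hl153, htl⟩ := heights_le hc hs hcs hle hl a1 a2
  have hr := lt_sqrtPhi
  have hr' := sqrtPhi_lt
  have hr0 := sqrtPhi_pos
  have h4 := sqrtPhi_pow_four
  set r := sqrtPhi
  -- At b = r - l the root b - b√(b² - 1) equals r - 1 for l = 0 and has slope about 1.84 in l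
  -- there; 2 rounds this up.
  have hp : p ≤ r - 1 + 2 * l := by
    refine leg_le (b := r - l) (by linarith) hc₁ hs₁ hcs₁ b1 b2 b3 (by linarith) ?_
    have : (r - l) ^ 2 * ((r - l) ^ 2 - 1) - (r - l - (r - 1 + 2 * l)) ^ 2
      = l * ((6 + 2 * r - 4 * (r ^ 2 * r)) + l * (6 * r ^ 2 - 10) - 4 * r * l ^ 2 + l ^ 3) := by
      linear_combination h4
    have f1 : r ^ 2 ≤ 1.2721 ^ 2 := by gcongr
    have f1' : 1.272 ^ 2 ≤ r ^ 2 := by gcongr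
    have f2 : r ^ 2 * r ≤ 1.2721 ^ 2 * 1.2721 := by gcongr
    have f3 : l ^ 2 ≤ 0.153 ^ 2 := by gcongr
    have f4 : r * l ^ 2 ≤ 1.2721 * 0.153 ^ 2 := by gcongr
    have f5 : 0 ≤ l ^ 3 := by positivity
    have f6 : l * (10 - 6 * r ^ 2) ≤ 0.153 * (10 - 6 * 1.272 ^ 2) := by
      apply mul_le_mul hl153 (by linarith) (by linarith) (by norm_num)
    have : 0 ≤ l * ((6 + 2 * r - 4 * (r ^ 2 * r)) + l * (6 * r ^ 2 - 10) - 4 * r * l ^ 2 + l ^ 3) :=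
      mul_nonneg hl (by linarith)
    linarith
  -- By `htl` the leg r - t is at least 1 + 0.6 l. Near b = 1 the root drops like a square root, so
  -- on l ≤ 0.153 it beats slope 2.1, which exceeds the 2 in `hp`.
  have hq : q ≤ 1 - 2.1 * l := by
    refine leg_le (b := 1 + 0.6 * l) (by linarith) hc₂ hs₂ hcs₂ ?_ d2 ?_ (by linarith) ?_
    · nlinarith
    · nlinarith
    · nlinarith [mul_nonneg hl hl, mul_nonneg (mul_nonneg hl hl) hl]
  exact ⟨by linarith, hp, hq⟩

/-- The equality case of `extremal_inequality`. -/
lemma extremal_rigidity {c s l t c₁ s₁ c₂ s₂ p q : ℝ}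
    (hc : 0 ≤ c) (hs : 0 ≤ s) (hcs : c ^ 2 + s ^ 2 = 1)
    (hc₁ : 0 ≤ c₁) (hs₁ : 0 ≤ s₁) (hcs₁ : c₁ ^ 2 + s₁ ^ 2 = 1)
    (hc₂ : 0 ≤ c₂) (hs₂ : 0 ≤ s₂) (hcs₂ : c₂ ^ 2 + s₂ ^ 2 = 1)
    (hle : c ≤ s) (hl : 0 ≤ l)
    (a1 : sqrtPhi * s + l * c ≤ 1) (a2 : sqrtPhi * c + t * s ≤ 1)
    (b1 : (sqrtPhi - l) * c₁ ≤ 1) (b2 : p * s₁ ≤ 1) (b3 : (sqrtPhi - l) * s₁ + p * c₁ ≤ 1)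
    (d1 : (sqrtPhi - t) * c₂ ≤ 1) (d2 : q * s₂ ≤ 1) (d3 : (sqrtPhi - t) * s₂ + q * c₂ ≤ 1)
    (hpq : p + q = sqrtPhi) :
    l = 0 ∧ t = sqrtPhi - 1 ∧ p = sqrtPhi - 1 ∧ (s = 1 / sqrtPhi ∧ c = 1 / sqrtPhi ^ 2) ∧
      (c₁ = 1 / sqrtPhi ∧ s₁ = 1 / sqrtPhi ^ 2) ∧ (c₂ = 0 ∧ s₂ = 1 ∨ c₂ = 1 ∧ s₂ = 0) := by
  obtain ⟨h1, h2, h3⟩ := extremal_inequality hc hs hcs hc₁ hs₁ hcs₁ hc₂ hs₂ hcs₂ hle hl a1 a2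
    b1 b2 b3 d1 d2 d3
  obtain ⟨-, htl⟩ := heights_le hc hs hcs hle hl a1 a2
  have hl0 : l = 0 := by linarith
  subst hl0
  have hp : p = sqrtPhi - 1 := by linarith
  have hq : q = 1 := by linarith
  subst hp hq
  have hcs' : s ^ 2 + c ^ 2 = 1 := by linarith
  -- Both legs are now at least 1, so `d3` forces s₂ + c₂ = 1: this square is axis-parallel.
  have key : t = sqrtPhi - 1 ∧ (c₂ = 0 ∧ s₂ = 1 ∨ c₂ = 1 ∧ s₂ = 0) := by
    have hsum := one_le_add_of_sq_add_sq hc₂ hs₂ hcs₂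
    have hb : 1 ≤ sqrtPhi - t := by linarith
    have hsc : s₂ + c₂ = 1 := by nlinarith
    have h0 : s₂ * c₂ = 0 := by nlinarith
    rcases mul_eq_zero.1 h0 with h | h
    · have : c₂ = 1 := by linarith
      subst this h
      exact ⟨by linarith, Or.inr ⟨rfl, rfl⟩⟩
    · have : s₂ = 1 := by linarith
      subst this h
      exact ⟨by linarith, Or.inl ⟨rfl, rfl⟩⟩
  obtain ⟨rfl, key⟩ := key
  refine ⟨rfl, rfl, rfl, ?_, ?_, key⟩
  · exact eq_of_height_eq hs hc hcs' (by linarith) (by linarith)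
  · exact eq_of_height_eq hc₁ hs₁ hcs₁ (by linarith) (by linarith)

/-! ### Unit squares in coordinates -/

/-- The unit square with edge directions `(c, s)` and `(-s, c)`, in coordinates. -/
def tiltedSquare (c s e f : ℝ) : Set Plane :=
  {x | c * x 0 + s * x 1 ∈ Set.Icc e (e + 1) ∧ -s * x 0 + c * x 1 ∈ Set.Icc f (f + 1)}

lemma mem_tiltedSquare {c s e f x y : ℝ} : !₂[x, y] ∈ tiltedSquare c s e f ↔
    (e ≤ c * x + s * y ∧ c * x + s * y ≤ e + 1) ∧
      (f ≤ -s * x + c * y ∧ -s * x + c * y ≤ f + 1) := by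
  simp [tiltedSquare]

lemma mem_stdSquare {a x y : ℝ} : !₂[x, y] ∈ stdSquare a ↔
    (0 ≤ x ∧ x ≤ a) ∧ (0 ≤ y ∧ y ≤ a) := by
  simp [stdSquare, Fin.forall_fin_two]

lemma tiltedSquare_quarter_turn (c s e f : ℝ) :
    tiltedSquare c s e f = tiltedSquare s (-c) (-f - 1) e := by
  ext x
  simp only [tiltedSquare, Set.mem_ofPred_eq, Set.mem_Icc]
  constructor <;> rintro ⟨⟨_, _⟩, _, _⟩ <;> refine ⟨⟨?_, ?_⟩, ?_, ?_⟩ <;> linarith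

/-- The edge directions are determined only up to quarter turns, so they can be turned into the
first quadrant. The new offsets are found by unification. -/
lemma tiltedSquare_nonneg (c s e f : ℝ) (h : c ^ 2 + s ^ 2 = 1) :
    ∃ c' s' e' f', 0 ≤ c' ∧ 0 ≤ s' ∧ c' ^ 2 + s' ^ 2 = 1 ∧
      tiltedSquare c s e f = tiltedSquare c' s' e' f' := by
  rcases le_total 0 c with hc | hc <;> rcases le_total 0 s with hs | hs
  · exact ⟨c, s, e, f, hc, hs, h, rfl⟩
  · refine ⟨-s, c, ?_, ?_, by linarith, hc, by linarith, ?_⟩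
    rotate_left 2
    · rw [tiltedSquare_quarter_turn, tiltedSquare_quarter_turn, tiltedSquare_quarter_turn, neg_neg]
  · refine ⟨s, -c, ?_, ?_, hs, by linarith, by linarith, ?_⟩
    rotate_left 2
    · rw [tiltedSquare_quarter_turn]
  · refine ⟨-c, -s, ?_, ?_, by linarith, by linarith, by linarith, ?_⟩
    rotate_left 2
    · rw [tiltedSquare_quarter_turn, tiltedSquare_quarter_turn]

/-- By Mazur–Ulam the inverse isometry is affine with orthogonal linear part. If the determinant is
-1, the second coordinate is reversed, whence the offset `k 1 - 1`. -/
lemma IsSquareOfEdge.exists_tiltedSquare {F : Set Plane} (hF : IsSquareOfEdge 1 F) :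
    ∃ c s e f, 0 ≤ c ∧ 0 ≤ s ∧ c ^ 2 + s ^ 2 = 1 ∧ F = tiltedSquare c s e f := by
  obtain ⟨-, g, rfl⟩ := hF
  let h := g.symm.toRealAffineIsometryEquiv
  let M := h.linearIsometryEquiv
  let k := g.symm 0
  have hM : ∀ y, g.symm y = M y + k := by
    intro y
    have := h.map_vadd 0 y
    simpa [h, M, k] using this
  let E0 : Plane := !₂[1, 0]
  let E1 : Plane := !₂[0, 1]
  have hy : ∀ y : Plane, y = y 0 • E0 + y 1 • E1 := by
    intro y; ext i; fin_cases i <;> simp [E0, E1]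
  have hMy : ∀ (y : Plane) i, g.symm y i = y 0 * M E0 i + y 1 * M E1 i + k i := by
    intro y i
    rw [hM]
    conv_lhs => rw [hy y]
    simp
  have hin : ∀ x y : Plane, inner ℝ x y = x 0 * y 0 + x 1 * y 1 := by
    intro x y
    simp [PiLp.inner_apply, Fin.sum_univ_two, mul_comm]
  have n0 : M E0 0 ^ 2 + M E0 1 ^ 2 = 1 := by
    have := M.inner_map_map E0 E0
    rw [hin, hin] at this
    simp [E0] at this
    linarith
  have n1 : M E1 0 ^ 2 + M E1 1 ^ 2 = 1 := by
    have := M.inner_map_map E1 E1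
    rw [hin, hin] at this
    simp [E1] at this
    linarith
  have n2 : M E0 0 * M E1 0 + M E0 1 * M E1 1 = 0 := by
    have := M.inner_map_map E0 E1
    rw [hin, hin] at this
    simp [E0, E1] at this
    linarith
  have hmem : ∀ y, y ∈ g '' stdSquare 1 ↔
      ∀ i, y 0 * M E0 i + y 1 * M E1 i + k i ∈ Set.Icc (0:ℝ) 1 := by
    intro y
    rw [← IsometryEquiv.preimage_symm]
    simp only [Set.mem_preimage, stdSquare, Set.mem_ofPred_eq, hMy]
  have hmem' : ∀ y, y ∈ g '' stdSquare 1 ↔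
      y 0 * M E0 0 + y 1 * M E1 0 + k 0 ∈ Set.Icc (0:ℝ) 1 ∧
      y 0 * M E0 1 + y 1 * M E1 1 + k 1 ∈ Set.Icc (0:ℝ) 1 := by
    intro y; rw [hmem, Fin.forall_fin_two]
  clear hmem hMy
  generalize M E0 0 = a at *
  generalize M E0 1 = b at *
  generalize M E1 0 = c at *
  generalize M E1 1 = d at *
  have hdet : (a * d - b * c - 1) * (a * d - b * c + 1) = 0 := by
    linear_combination n0 * (c ^ 2 + d ^ 2) + n1 - n2 * (a * c + b * d)
  rcases mul_eq_zero.1 hdet with hd | hd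
  · have e : (c + b) ^ 2 + (d - a) ^ 2 = 0 := by linear_combination n0 + n1 - 2 * hd
    have e1 : c = -b := by nlinarith [sq_nonneg (c + b), sq_nonneg (d - a)]
    have e2 : d = a := by nlinarith [sq_nonneg (c + b), sq_nonneg (d - a)]
    subst e1 e2
    obtain ⟨c', s', e', f', h1, h2, h3, h4⟩ :=
      tiltedSquare_nonneg d (-b) (-k 0) (-k 1) (by linarith)
    refine ⟨c', s', e', f', h1, h2, h3, ?_⟩
    rw [← h4]
    ext y
    rw [hmem']
    simp only [tiltedSquare, Set.mem_ofPred_eq, Set.mem_Icc]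
    constructor <;> rintro ⟨⟨_, _⟩, _, _⟩ <;> refine ⟨⟨?_, ?_⟩, ?_, ?_⟩ <;> linarith
  · have e : (c - b) ^ 2 + (d + a) ^ 2 = 0 := by linear_combination n0 + n1 + 2 * hd
    have e1 : c = b := by nlinarith [sq_nonneg (c - b), sq_nonneg (d + a)]
    have e2 : d = -a := by nlinarith [sq_nonneg (c - b), sq_nonneg (d + a)]
    subst e1 e2
    obtain ⟨c', s', e', f', h1, h2, h3, h4⟩ :=
      tiltedSquare_nonneg a c (-k 0) (k 1 - 1) (by linarith)
    refine ⟨c', s', e', f', h1, h2, h3, ?_⟩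
    rw [← h4]
    ext y
    rw [hmem']
    simp only [tiltedSquare, Set.mem_ofPred_eq, Set.mem_Icc]
    constructor <;> rintro ⟨⟨_, _⟩, _, _⟩ <;> refine ⟨⟨?_, ?_⟩, ?_, ?_⟩ <;> linarith

/-! ### Topology and symmetries of the square -/

lemma isClosed_stdSquare (a : ℝ) : IsClosed (stdSquare a) := by
  have : stdSquare a = ⋂ i, (fun x : Plane => x i) ⁻¹' Set.Icc 0 a := by
    ext x; simp [stdSquare]
  rw [this]
  exact isClosed_iInter fun i => isClosed_Icc.preimage (by fun_prop)

lemma isClosed_of_isSquareOfEdge {a : ℝ} {Q : Set Plane} (h : IsSquareOfEdge a Q) :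
    IsClosed Q := by
  obtain ⟨-, g, rfl⟩ := h
  exact g.toHomeomorph.isClosedMap _ (isClosed_stdSquare a)

lemma mem_frontier_stdSquare {a : ℝ} {x : Plane} (hx : x ∈ stdSquare a) {i : Fin 2}
    (hi : x i = 0 ∨ x i = a) : x ∈ frontier (stdSquare a) := by
  rw [(isClosed_stdSquare a).frontier_eq]
  refine ⟨hx, fun hint => ?_⟩
  have hsub : stdSquare a ⊆ (fun y : Plane => y i) ⁻¹' Set.Icc 0 a := fun y hy => hy i
  have h1 := interior_mono hsub hint
  have hopen : IsOpenMap (fun y : Plane => y i) := by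
    have h := (EuclideanSpace.proj i : Plane →L[ℝ] ℝ).isOpenMap fun r =>
      ⟨EuclideanSpace.single i r, by simp⟩
    exact h
  rw [← hopen.preimage_interior_eq_interior_preimage (by fun_prop), interior_Icc] at h1
  rcases hi with hi | hi
  · exact absurd h1.1 (by simp [hi])
  · exact absurd h1.2 (by simp [hi])

lemma IsSquareOfEdge.image {a : ℝ} {Q : Set Plane} (h : IsSquareOfEdge a Q) (g : Plane ≃ᵢ Plane) :
    IsSquareOfEdge a (g '' Q) := by
  obtain ⟨ha, k, rfl⟩ := h
  exact ⟨ha, k.trans g, by rw [Set.image_image]; rfl⟩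

lemma IsometryEquiv.image_frontier (g : Plane ≃ᵢ Plane) (S : Set Plane) :
    g '' frontier S = frontier (g '' S) :=
  g.toHomeomorph.image_frontier S

lemma image_translate (g : Plane ≃ᵢ Plane) (S : Set Plane) (v : Plane) :
    ∃ w, g '' ((fun x => x + v) '' S) = (fun x => x + w) '' (g '' S) := by
  refine ⟨g v - g 0, ?_⟩
  rw [Set.image_image, Set.image_image]
  refine Set.image_congr fun x _ => ?_
  let h := g.toRealAffineIsometryEquiv
  have h1 : g (x + v) = h.linearIsometryEquiv x + g v := h.map_vadd v x
  have h2 : g (x + 0) = h.linearIsometryEquiv x + g 0 := h.map_vadd 0 x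
  rw [add_zero] at h2
  rw [h1, h2]
  abel

/-- The quarter turn about the centre of `stdSquare a`. -/
def quarterTurn (a : ℝ) : Plane ≃ᵢ Plane where
  toFun x := !₂[a - x 1, x 0]
  invFun x := !₂[x 1, a - x 0]
  left_inv x := by ext i; fin_cases i <;> simp
  right_inv x := by ext i; fin_cases i <;> simp
  isometry_toFun := Isometry.of_dist_eq fun x y => by
    simp only [EuclideanSpace.dist_eq, Fin.sum_univ_two, Real.dist_eq, sq_abs]
    congr 1
    simp
    ring

/-- The reflection of the plane in the vertical line through the centre of `stdSquare a`. -/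
def mirror (a : ℝ) : Plane ≃ᵢ Plane where
  toFun x := !₂[a - x 0, x 1]
  invFun x := !₂[a - x 0, x 1]
  left_inv x := by ext i; fin_cases i <;> simp
  right_inv x := by ext i; fin_cases i <;> simp
  isometry_toFun := Isometry.of_dist_eq fun x y => by
    simp only [EuclideanSpace.dist_eq, Fin.sum_univ_two, Real.dist_eq, sq_abs]
    congr 1
    simp
    ring

lemma mem_image_quarterTurn {a x y : ℝ} {S : Set Plane} :
    !₂[x, y] ∈ quarterTurn a '' S ↔ !₂[y, a - x] ∈ S := by
  rw [← IsometryEquiv.preimage_symm]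
  rfl

lemma mem_image_mirror {a x y : ℝ} {S : Set Plane} :
    !₂[x, y] ∈ mirror a '' S ↔ !₂[a - x, y] ∈ S := by
  rw [← IsometryEquiv.preimage_symm]
  rfl

lemma Plane.forall {P : Plane → Prop} : (∀ z, P z) ↔ ∀ x y : ℝ, P !₂[x, y] := by
  refine ⟨fun h x y => h _, fun h z => ?_⟩
  have hz : z = !₂[z 0, z 1] := by ext i; fin_cases i <;> rfl
  rw [hz]; exact h _ _

lemma quarterTurn_image_stdSquare (a : ℝ) : quarterTurn a '' stdSquare a = stdSquare a := by
  rw [Set.ext_iff, Plane.forall]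
  intro x y
  rw [mem_image_quarterTurn, mem_stdSquare, mem_stdSquare]
  constructor <;> rintro ⟨⟨_, _⟩, _, _⟩ <;> refine ⟨⟨?_, ?_⟩, ?_, ?_⟩ <;> linarith

lemma mirror_image_stdSquare (a : ℝ) : mirror a '' stdSquare a = stdSquare a := by
  rw [Set.ext_iff, Plane.forall]
  intro x y
  rw [mem_image_mirror, mem_stdSquare, mem_stdSquare]
  constructor <;> rintro ⟨⟨_, _⟩, _, _⟩ <;> refine ⟨⟨?_, ?_⟩, ?_, ?_⟩ <;> linarith

lemma mirror_image_tiltedSquare (a c s e f : ℝ) :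
    mirror a '' tiltedSquare c s e f = tiltedSquare s c (f + s * a) (e - c * a) := by
  rw [Set.ext_iff, Plane.forall]
  intro x y
  rw [mem_image_mirror, mem_tiltedSquare, mem_tiltedSquare]
  constructor <;> rintro ⟨⟨_, _⟩, _, _⟩ <;> refine ⟨⟨?_, ?_⟩, ?_, ?_⟩ <;> linarith

/-- A segment covered by two closed sets, one containing each endpoint, meets their
intersection. -/
lemma exists_mem_inter {A B : Set Plane} (hA : IsClosed A) (hB : IsClosed B) {γ : ℝ → Plane}
    (hγ : Continuous γ) {m : ℝ} (hm : 0 ≤ m) (h0 : γ 0 ∈ A) (h1 : γ m ∈ B)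
    (hcov : ∀ y, 0 ≤ y → y ≤ m → γ y ∈ A ∨ γ y ∈ B) :
    ∃ y, 0 ≤ y ∧ y ≤ m ∧ γ y ∈ A ∧ γ y ∈ B := by
  have := isPreconnected_closed_iff.1 (isPreconnected_Icc (a := (0:ℝ)) (b := m)) _ _
    (hA.preimage hγ) (hB.preimage hγ) (fun y hy => hcov y hy.1 hy.2)
    ⟨0, ⟨le_rfl, hm⟩, h0⟩ ⟨m, ⟨hm, le_rfl⟩, h1⟩
  obtain ⟨y, hy, h⟩ := this
  exact ⟨y, hy.1, hy.2, h.1, h.2⟩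

lemma edges_covered {a : ℝ} (ha : 0 ≤ a) {P : Plane → Prop}
    (h : ∀ z ∈ frontier (stdSquare a), P z) {y : ℝ} (hy : 0 ≤ y) (hya : y ≤ a) :
    P !₂[0, y] ∧ P !₂[a, y] ∧ P !₂[y, 0] ∧ P !₂[y, a] := by
  refine ⟨h _ (mem_frontier_stdSquare (i := 0) (mem_stdSquare.2 ?_) (by simp)),
    h _ (mem_frontier_stdSquare (i := 0) (mem_stdSquare.2 ?_) (by simp)),
    h _ (mem_frontier_stdSquare (i := 1) (mem_stdSquare.2 ?_) (by simp)),
    h _ (mem_frontier_stdSquare (i := 1) (mem_stdSquare.2 ?_) (by simp))⟩ <;> simp [*]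

lemma dist_sq_le_two {c s e f x y x' y' : ℝ} (h : c ^ 2 + s ^ 2 = 1)
    (h1 : !₂[x, y] ∈ tiltedSquare c s e f) (h2 : !₂[x', y'] ∈ tiltedSquare c s e f) :
    (x - x') ^ 2 + (y - y') ^ 2 ≤ 2 := by
  rw [mem_tiltedSquare] at h1 h2
  have e1 : (c * (x - x') + s * (y - y')) ^ 2 ≤ 1 :=
    (sq_le_one_iff_abs_le_one _).2 (abs_le.2 ⟨by linarith, by linarith⟩)
  have e2 : (-s * (x - x') + c * (y - y')) ^ 2 ≤ 1 :=
    (sq_le_one_iff_abs_le_one _).2 (abs_le.2 ⟨by linarith, by linarith⟩)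
  have : (x - x') ^ 2 + (y - y') ^ 2 = (c * (x - x') + s * (y - y')) ^ 2
      + (-s * (x - x') + c * (y - y')) ^ 2 := by
    linear_combination -((x - x') ^ 2 + (y - y') ^ 2) * h
  linarith

lemma IsSquareOfEdge.dist_sq_le_two {F : Set Plane} (hF : IsSquareOfEdge 1 F) {x y x' y' : ℝ}
    (h1 : !₂[x, y] ∈ F) (h2 : !₂[x', y'] ∈ F) : (x - x') ^ 2 + (y - y') ^ 2 ≤ 2 := by
  obtain ⟨c, s, e, f, hc, hs, hcs, rfl⟩ := hF.exists_tiltedSquare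
  exact _root_.dist_sq_le_two hcs h1 h2

/-! ### Two squares -/

lemma tiltedSquare_eq_translate {c s e f : ℝ} (hc : 0 ≤ c) (hs : 0 ≤ s) (h : c ^ 2 + s ^ 2 = 1)
    (h0 : c * s = 0) : ∃ v : Plane, tiltedSquare c s e f = (fun x => x + v) '' stdSquare 1 := by
  have key : ∀ v z : Plane, z ∈ (fun x => x + v) '' stdSquare 1 ↔ z - v ∈ stdSquare 1 := by
    intro v z
    constructor
    · rintro ⟨x, hx, rfl⟩; simpa using hx
    · intro hz; exact ⟨z - v, hz, by simp⟩
  rcases mul_eq_zero.1 h0 with rfl | rfl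
  · have : s = 1 := by nlinarith
    subst this
    refine ⟨!₂[-f - 1, e], ?_⟩
    rw [Set.ext_iff, Plane.forall]
    intro x y
    rw [key, mem_tiltedSquare]
    simp only [stdSquare, Set.mem_ofPred_eq, Fin.forall_fin_two, Set.mem_Icc, PiLp.sub_apply]
    simp
    constructor <;> rintro ⟨⟨_, _⟩, _, _⟩ <;> refine ⟨⟨?_, ?_⟩, ?_, ?_⟩ <;> linarith
  · have : c = 1 := by nlinarith
    subst this
    refine ⟨!₂[e, f], ?_⟩
    rw [Set.ext_iff, Plane.forall]
    intro x y
    rw [key, mem_tiltedSquare]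
    simp only [stdSquare, Set.mem_ofPred_eq, Fin.forall_fin_two, Set.mem_Icc, PiLp.sub_apply]
    simp
    constructor <;> rintro ⟨⟨_, _⟩, _, _⟩ <;> refine ⟨⟨?_, ?_⟩, ?_, ?_⟩ <;> linarith

lemma translate_of_diagonal {a : ℝ} (ha : 1 ≤ a) {A : Set Plane} (hA : IsSquareOfEdge 1 A)
    (h : !₂[0, 0] ∈ A ∧ !₂[a, a] ∈ A ∨ !₂[a, 0] ∈ A ∧ !₂[0, a] ∈ A) :
    a = 1 ∧ ∃ v : Plane, A = (fun x => x + v) '' stdSquare 1 := by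
  obtain ⟨c, s, e, f, hc, hs, hcs, rfl⟩ := hA.exists_tiltedSquare
  simp only [mem_tiltedSquare] at h
  have hsum := one_le_add_of_sq_add_sq hc hs hcs
  have h1 : (c + s) * a ≤ 1 := by rcases h with h | h <;> linarith
  have ha1 : a = 1 := by nlinarith
  subst ha1
  exact ⟨rfl, tiltedSquare_eq_translate hc hs hcs (by nlinarith)⟩

lemma translate_of_opposite_edges {a : ℝ} (ha : 1 ≤ a) {A B : Set Plane}
    (hA : IsSquareOfEdge 1 A) (hB : IsSquareOfEdge 1 B)
    (hcov : ∀ z ∈ frontier (stdSquare a), z ∈ A ∨ z ∈ B)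
    (h00 : !₂[0, 0] ∈ A) (h10 : !₂[a, 0] ∈ A) (h01 : !₂[0, a] ∈ B) (h11 : !₂[a, a] ∈ B) :
    a = 1 ∧ ((∃ v : Plane, A = (fun x => x + v) '' stdSquare 1) ∨
      ∃ v : Plane, B = (fun x => x + v) '' stdSquare 1) := by
  have ha0 : 0 ≤ a := by linarith
  obtain ⟨l, hl0, hla, hlA, hlB⟩ := exists_mem_inter (isClosed_of_isSquareOfEdge hA)
    (isClosed_of_isSquareOfEdge hB) (γ := fun y => !₂[0, y]) (by fun_prop) ha0 h00 h01
    fun y h h' => (edges_covered ha0 hcov h h').1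
  obtain ⟨t, ht0, hta, htA, htB⟩ := exists_mem_inter (isClosed_of_isSquareOfEdge hA)
    (isClosed_of_isSquareOfEdge hB) (γ := fun y => !₂[a, y]) (by fun_prop) ha0 h10 h11
    fun y h h' => (edges_covered ha0 hcov h h').2.1
  obtain ⟨c, s, e, f, hc, hs, hcs, rfl⟩ := hA.exists_tiltedSquare
  obtain ⟨c', s', e', f', hc', hs', hcs', rfl⟩ := hB.exists_tiltedSquare
  rw [mem_tiltedSquare] at *
  rcases le_total a (l + t) with h | h
  · obtain ⟨rfl, h0⟩ := eq_one_of_trapezoid (c := c) (s := s) ha hc hs hcs (t := t) (l := l)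
      (by linarith) (by linarith) h
    exact ⟨rfl, Or.inl (tiltedSquare_eq_translate hc hs hcs h0)⟩
  -- B hangs from the top edge, so left and right exchange roles.
  · obtain ⟨rfl, h0⟩ := eq_one_of_trapezoid (c := c') (s := s') ha hc' hs' hcs' (t := a - l)
      (l := a - t) (by linarith) (by linarith) (by linarith)
    exact ⟨rfl, Or.inr (tiltedSquare_eq_translate hc' hs' hcs' h0)⟩

lemma frontier_cover_image {ι : Type*} {a : ℝ} {F : ι → Set Plane} (ρ : Plane ≃ᵢ Plane)
    (hρ : ρ '' stdSquare a = stdSquare a) (hcov : frontier (stdSquare a) ⊆ ⋃ i, F i) :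
    frontier (stdSquare a) ⊆ ⋃ i, ρ '' F i := by
  conv_lhs => rw [← hρ]
  rw [← ρ.image_frontier, ← Set.image_iUnion]
  exact Set.image_mono hcov

/-- If no square holds a diagonal, the corners split into two adjacent pairs; a quarter turn makes
these the bottom and top pairs. -/
lemma two_squares {a : ℝ} (ha : 1 ≤ a) {F : Fin 2 → Set Plane}
    (hF : ∀ i, IsSquareOfEdge 1 (F i)) (hcov : frontier (stdSquare a) ⊆ ⋃ i, F i) :
    a = 1 ∧ ∃ (i : Fin 2) (v : Plane), F i = (fun x => x + v) '' stdSquare 1 := by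
  have ha0 : 0 ≤ a := by linarith
  by_cases hdiag : ∃ i, !₂[0, 0] ∈ F i ∧ !₂[a, a] ∈ F i ∨ !₂[a, 0] ∈ F i ∧ !₂[0, a] ∈ F i
  · obtain ⟨i, hi⟩ := hdiag
    obtain ⟨h1, h2⟩ := translate_of_diagonal ha (hF i) hi
    exact ⟨h1, i, h2⟩
  push Not at hdiag
  have hopp : ∀ G : Fin 2 → Set Plane, (∀ i, IsSquareOfEdge 1 (G i)) →
      frontier (stdSquare a) ⊆ ⋃ i, G i → ∀ i j, i ≠ j → !₂[0, 0] ∈ G i → !₂[a, 0] ∈ G i →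
      !₂[0, a] ∈ G j → !₂[a, a] ∈ G j →
      a = 1 ∧ ∃ (i : Fin 2) (v : Plane), G i = (fun x => x + v) '' stdSquare 1 := by
    intro G hG hGc i j hij h1 h2 h3 h4
    have : ∀ z ∈ frontier (stdSquare a), z ∈ G i ∨ z ∈ G j := by
      intro z hz
      obtain ⟨k, hk⟩ := Set.mem_iUnion.1 (hGc hz)
      have : k = i ∨ k = j := by omega
      rcases this with rfl | rfl
      · exact Or.inl hk
      · exact Or.inr hk
    obtain ⟨e, h | h⟩ := translate_of_opposite_edges ha (hG i) (hG j) this h1 h2 h3 h4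
    · exact ⟨e, i, h⟩
    · exact ⟨e, j, h⟩
  have hv := fun {y : ℝ} (h : 0 ≤ y) (h' : y ≤ a) =>
    edges_covered ha0 (P := fun z => ∃ i, z ∈ F i) (fun z hz => Set.mem_iUnion.1 (hcov hz)) h h'
  obtain ⟨i00, h00⟩ := (hv le_rfl ha0).1
  obtain ⟨i10, h10⟩ := (hv le_rfl ha0).2.1
  obtain ⟨i01, h01⟩ := (hv ha0 le_rfl).1
  obtain ⟨i11, h11⟩ := (hv ha0 le_rfl).2.1
  have n1 : i00 ≠ i11 := by rintro rfl; exact (hdiag i00).1 h00 h11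
  have n2 : i10 ≠ i01 := by rintro rfl; exact (hdiag i10).2 h10 h01
  by_cases h : i00 = i10
  · subst h
    have : i11 = i01 := by omega
    subst this
    exact hopp F hF hcov _ _ n1 h00 h10 h01 h11
  · have e1 : i00 = i01 := by omega
    have e2 : i11 = i10 := by omega
    subst e1 e2
    obtain ⟨e, i, v, hv⟩ := hopp (fun i => quarterTurn a '' F i) (fun i => (hF i).image _)
      (frontier_cover_image _ (quarterTurn_image_stdSquare a) hcov) i00 i11 n1
      (by rw [mem_image_quarterTurn]; simpa using h01)
      (by rw [mem_image_quarterTurn]; simpa using h00)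
      (by rw [mem_image_quarterTurn]; simpa using h11)
      (by rw [mem_image_quarterTurn]; simpa using h10)
    subst e
    refine ⟨rfl, i, ?_⟩
    have h2 := congrArg (fun S => (quarterTurn 1).symm '' S) hv
    obtain ⟨w, hw⟩ := image_translate (quarterTurn 1).symm (stdSquare 1) v
    have h3 : (quarterTurn 1).symm '' stdSquare 1 = stdSquare 1 := by
      conv_lhs => rw [← quarterTurn_image_stdSquare 1]
      simp [Set.image_image]
    refine ⟨w, ?_⟩
    simp only [hw, h3] at h2
    simpa [Set.image_image] using h2

/-! ### The extremal squares -/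

/-- `rot θ` as an isometry. -/
noncomputable def rotIso (θ : ℝ) : Plane ≃ᵢ Plane where
  toFun := rot θ
  invFun := rot (-θ)
  left_inv x := by
    have := Real.cos_sq_add_sin_sq θ
    ext i; fin_cases i <;> simp [rot]
    · linear_combination x 0 * this
    · linear_combination x 1 * this
  right_inv x := by
    have := Real.cos_sq_add_sin_sq θ
    ext i; fin_cases i <;> simp [rot]
    · linear_combination x 0 * this
    · linear_combination x 1 * this
  isometry_toFun := Isometry.of_dist_eq fun x y => by
    simp only [EuclideanSpace.dist_eq, Fin.sum_univ_two, Real.dist_eq, sq_abs]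
    congr 1
    simp [rot]
    linear_combination ((x 0 - y 0) ^ 2 + (x 1 - y 1) ^ 2) * Real.cos_sq_add_sin_sq θ

lemma mem_image_rot {θ x y a : ℝ} : !₂[x, y] ∈ rot θ '' stdSquare a ↔
    !₂[Real.cos θ * x + Real.sin θ * y, -Real.sin θ * x + Real.cos θ * y] ∈ stdSquare a := by
  change !₂[x, y] ∈ rotIso θ '' stdSquare a ↔ _
  rw [← IsometryEquiv.preimage_symm]
  change rot (-θ) !₂[x, y] ∈ stdSquare a ↔ _
  simp [rot]

lemma cos_arccos_inv_sqrtPhi : Real.cos (Real.arccos (1 / sqrtPhi)) = 1 / sqrtPhi := by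
  have := lt_sqrtPhi
  have h0 := sqrtPhi_pos
  have : 0 ≤ 1 / sqrtPhi := by positivity
  apply Real.cos_arccos (by linarith)
  rw [div_le_one h0]; linarith

lemma sin_arccos_inv_sqrtPhi : Real.sin (Real.arccos (1 / sqrtPhi)) = 1 / sqrtPhi ^ 2 := by
  have h0 := sqrtPhi_pos
  rw [Real.sin_arccos, (_ : 1 - (1 / sqrtPhi) ^ 2 = (1 / sqrtPhi ^ 2) ^ 2)]
  · exact Real.sqrt_sq (by positivity)
  · field_simp; linarith [sqrtPhi_pow_four]

/-- The direction (1/√φ, -1/√φ²) is turned into the first quadrant, whence the offset -1. -/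
lemma extremalSquares_zero :
    extremalSquares 0 = tiltedSquare (1 / sqrtPhi ^ 2) (1 / sqrtPhi) 0 (-1) := by
  change rot _ '' _ = _
  rw [Set.ext_iff, Plane.forall]
  intro x y
  rw [mem_image_rot, mem_stdSquare, mem_tiltedSquare, Real.cos_neg, Real.sin_neg,
    cos_arccos_inv_sqrtPhi, sin_arccos_inv_sqrtPhi]
  constructor <;> rintro ⟨⟨_, _⟩, _, _⟩ <;> refine ⟨⟨?_, ?_⟩, ?_, ?_⟩ <;> linarith

lemma extremalSquares_one :
    extremalSquares 1 = tiltedSquare (1 / sqrtPhi) (1 / sqrtPhi ^ 2) 0 0 := by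
  change rot _ '' _ = _
  rw [Set.ext_iff, Plane.forall]
  intro x y
  rw [mem_image_rot, mem_stdSquare, mem_tiltedSquare,
    cos_arccos_inv_sqrtPhi, sin_arccos_inv_sqrtPhi]
  constructor <;> rintro ⟨⟨_, _⟩, _, _⟩ <;> refine ⟨⟨?_, ?_⟩, ?_, ?_⟩ <;> linarith

lemma mem_extremalSquares_two {z : Plane} : z ∈ extremalSquares 2 ↔
    (sqrtPhi - 1 ≤ z 0 ∧ z 0 ≤ sqrtPhi) ∧ (sqrtPhi - 1 ≤ z 1 ∧ z 1 ≤ sqrtPhi) := by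
  have h0 := sqrtPhi_pos
  change z ∈ AffineMap.homothety _ _ '' _ ↔ _
  have hcoord : ∀ (w : Plane) (i : Fin 2),
      AffineMap.homothety (!₂[sqrtPhi, sqrtPhi] : Plane) (1 / sqrtPhi) w i
        = 1 / sqrtPhi * w i + (sqrtPhi - 1) := by
    intro w i
    have : ![sqrtPhi, sqrtPhi] i = sqrtPhi := by fin_cases i <;> rfl
    simp only [AffineMap.homothety_apply, vsub_eq_sub, vadd_eq_add, PiLp.add_apply,
      PiLp.smul_apply, PiLp.sub_apply, this, smul_eq_mul]
    field_simp
    ring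
  have hdiv : ∀ u, 1 / sqrtPhi * (sqrtPhi * u) = u := by intro u; field_simp
  constructor
  · rintro ⟨w, hw, rfl⟩
    have hb : ∀ i, 0 ≤ 1 / sqrtPhi * w i ∧ 1 / sqrtPhi * w i ≤ 1 := by
      intro i
      refine ⟨mul_nonneg (by positivity) (hw i).1, ?_⟩
      rw [one_div, inv_mul_le_iff₀ h0]
      linarith [(hw i).2]
    rw [hcoord, hcoord]
    have := hb 0
    have := hb 1
    refine ⟨⟨?_, ?_⟩, ?_, ?_⟩ <;> linarith
  · intro h
    refine ⟨!₂[sqrtPhi * (z 0 - (sqrtPhi - 1)), sqrtPhi * (z 1 - (sqrtPhi - 1))], ?_, ?_⟩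
    · rw [mem_stdSquare]
      refine ⟨⟨mul_nonneg h0.le (by linarith), ?_⟩, mul_nonneg h0.le (by linarith), ?_⟩ <;>
        exact mul_le_of_le_one_right h0.le (by linarith)
    · ext i
      rw [hcoord]
      fin_cases i <;> simp [h0.ne']

lemma isSquareOfEdge_extremalSquares (i : Fin 3) : IsSquareOfEdge 1 (extremalSquares i) := by
  fin_cases i
  · exact ⟨one_pos, rotIso _, rfl⟩
  · exact ⟨one_pos, rotIso _, rfl⟩
  · refine ⟨one_pos, IsometryEquiv.addRight !₂[sqrtPhi - 1, sqrtPhi - 1], ?_⟩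
    ext z
    rw [← IsometryEquiv.preimage_symm]
    change z ∈ extremalSquares 2 ↔ _
    rw [mem_extremalSquares_two]
    simp only [stdSquare, Set.mem_preimage, Set.mem_ofPred_eq, Fin.forall_fin_two, Set.mem_Icc]
    simp
    constructor <;> rintro ⟨⟨_, _⟩, _, _⟩ <;> refine ⟨⟨?_, ?_⟩, ?_, ?_⟩ <;> linarith

/-- The third square takes x, y ≥ √φ - 1. In the strip y ≤ √φ - 1, the common edge line x = y/√φ
through the origin separates the parts taken by the first two; the other strip is its mirror image
in the diagonal. -/
lemma stdSquare_sqrtPhi_subset : stdSquare sqrtPhi ⊆ ⋃ i, extremalSquares i := by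
  suffices ∀ z, z ∈ stdSquare sqrtPhi → ∃ i, z ∈ extremalSquares i from
    fun z hz => Set.mem_iUnion.2 (this z hz)
  rw [Plane.forall]
  intro x y hxy
  rw [mem_stdSquare] at hxy
  have hr0 := sqrtPhi_pos
  have hr := lt_sqrtPhi
  have hr' := sqrtPhi_lt
  have key : ∀ x y : ℝ, 0 ≤ x → x ≤ sqrtPhi → 0 ≤ y → y ≤ sqrtPhi - 1 →
      (1 / sqrtPhi ^ 2 * y ≤ 1 / sqrtPhi * x → 1 / sqrtPhi ^ 2 * x + 1 / sqrtPhi * y ≤ 1) ∧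
      (1 / sqrtPhi * x ≤ 1 / sqrtPhi ^ 2 * y → 1 / sqrtPhi ^ 2 * x ≤ 1 / sqrtPhi * y ∧
        1 / sqrtPhi * x + 1 / sqrtPhi ^ 2 * y ≤ 1) ∧
      0 ≤ 1 / sqrtPhi * x ∧ 0 ≤ 1 / sqrtPhi ^ 2 * x ∧ 0 ≤ 1 / sqrtPhi * y ∧
      0 ≤ 1 / sqrtPhi ^ 2 * y ∧ 1 / sqrtPhi * x ≤ 1 ∧ 1 / sqrtPhi * y ≤ 1 := by
    intro x y hx hxr hy hyr
    have hx1 : 1 / sqrtPhi * x ≤ 1 := by rw [one_div, inv_mul_le_iff₀ hr0]; linarith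
    have hy1 : 1 / sqrtPhi * y ≤ 1 := by rw [one_div, inv_mul_le_iff₀ hr0]; linarith
    have hk : 1 / sqrtPhi ^ 2 ≤ 1 / sqrtPhi := by
      apply one_div_le_one_div_of_le hr0; nlinarith
    refine ⟨fun _ => ?_, fun h => ⟨?_, ?_⟩, by positivity, by positivity, by positivity,
      by positivity, hx1, hy1⟩
    -- Tight at (√φ, √φ - 1), where the first square leaves the right edge.
    · calc 1 / sqrtPhi ^ 2 * x + 1 / sqrtPhi * y
          ≤ 1 / sqrtPhi ^ 2 * sqrtPhi + 1 / sqrtPhi * (sqrtPhi - 1) := by gcongr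
        _ = 1 := by field_simp; ring
    · calc 1 / sqrtPhi ^ 2 * x ≤ 1 / sqrtPhi * x := by gcongr
        _ ≤ 1 / sqrtPhi ^ 2 * y := h
        _ ≤ 1 / sqrtPhi * y := by gcongr
    · have : 1 / sqrtPhi ^ 2 * y ≤ 1 * (1 / 2) := by
        gcongr
        · rw [div_le_one (by positivity)]; nlinarith
        · linarith
      linarith
  by_cases hy : y ≤ sqrtPhi - 1
  · obtain ⟨k1, k2, k3, k4, k5, k6, k7, k8⟩ := key x y hxy.1.1 hxy.1.2 hxy.2.1 hy
    rcases le_total (1 / sqrtPhi ^ 2 * y) (1 / sqrtPhi * x) with h | h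
    · have := k1 h
      refine ⟨0, ?_⟩
      rw [extremalSquares_zero, mem_tiltedSquare]
      refine ⟨⟨?_, ?_⟩, ?_, ?_⟩ <;> linarith
    · have := k2 h
      refine ⟨1, ?_⟩
      rw [extremalSquares_one, mem_tiltedSquare]
      refine ⟨⟨?_, ?_⟩, ?_, ?_⟩ <;> linarith
  by_cases hx : x ≤ sqrtPhi - 1
  · obtain ⟨k1, k2, k3, k4, k5, k6, k7, k8⟩ := key y x hxy.2.1 hxy.2.2 hxy.1.1 hx
    rcases le_total (1 / sqrtPhi ^ 2 * x) (1 / sqrtPhi * y) with h | h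
    · have := k1 h
      refine ⟨1, ?_⟩
      rw [extremalSquares_one, mem_tiltedSquare]
      refine ⟨⟨?_, ?_⟩, ?_, ?_⟩ <;> linarith
    · have := k2 h
      refine ⟨0, ?_⟩
      rw [extremalSquares_zero, mem_tiltedSquare]
      refine ⟨⟨?_, ?_⟩, ?_, ?_⟩ <;> linarith
  · push Not at hx hy
    exact ⟨2, mem_extremalSquares_two.2 ⟨⟨by simpa using hx.le, by simpa using hxy.1.2⟩,
      by simpa using hy.le, by simpa using hxy.2.2⟩⟩

/-! ### Three squares -/

lemma base_heights {a c s e f : ℝ} (ha : sqrtPhi ≤ a) (hc : 0 ≤ c) (hs : 0 ≤ s)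
    (hcs : c ^ 2 + s ^ 2 = 1) {x₀ y₀ : ℝ} (h0 : !₂[x₀, y₀] ∈ tiltedSquare c s e f)
    (h1 : !₂[x₀ + a, y₀] ∈ tiltedSquare c s e f) {y : ℝ}
    (hy : !₂[x₀, y] ∈ tiltedSquare c s e f ∨ !₂[x₀ + a, y] ∈ tiltedSquare c s e f) :
    |y - y₀| ≤ a - 1 := by
  have hcs' : s ^ 2 + c ^ 2 = 1 := by linarith
  rw [mem_tiltedSquare] at h0 h1
  rw [mem_tiltedSquare, mem_tiltedSquare] at hy
  refine abs_le'.2 ⟨?_, ?_⟩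
  · rcases hy with hy | hy
    · exact height_le ha hc hs hcs (by linarith) (by linarith)
    · exact height_le ha hs hc hcs' (by linarith) (by linarith)
  · rcases hy with hy | hy
    · exact height_le ha hs hc hcs' (by linarith) (by linarith)
    · exact height_le ha hc hs hcs (by linarith) (by linarith)

lemma IsSquareOfEdge.base_heights {a : ℝ} (ha : sqrtPhi ≤ a) {A : Set Plane}
    (hA : IsSquareOfEdge 1 A) {y₀ : ℝ} (h0 : !₂[0, y₀] ∈ A) (h1 : !₂[a, y₀] ∈ A) {y : ℝ}
    (hy : !₂[0, y] ∈ A ∨ !₂[a, y] ∈ A) : |y - y₀| ≤ a - 1 := by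
  obtain ⟨c, s, e, f, hc, hs, hcs, rfl⟩ := hA.exists_tiltedSquare
  exact _root_.base_heights ha hc hs hcs h0 (by simpa using h1) (by simpa using hy)

/-- A triangle of base and height a satisfies the trapezoid inequalities with heights a - x and x,
whose sum is a. -/
lemma not_mem_top_of_bottom {a : ℝ} (ha : sqrtPhi ≤ a) {A : Set Plane} (hA : IsSquareOfEdge 1 A)
    (h0 : !₂[0, 0] ∈ A) (h1 : !₂[a, 0] ∈ A) (x : ℝ) : !₂[x, a] ∉ A := by
  intro hx
  have := lt_sqrtPhi
  obtain ⟨c, s, e, f, hc, hs, hcs, rfl⟩ := hA.exists_tiltedSquare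
  rw [mem_tiltedSquare] at h0 h1 hx
  have := (eq_one_of_trapezoid (a := a) (c := s) (s := c) (l := a - x) (t := x) (by linarith)
    hs hc (by linarith) (by linarith) (by linarith) (by linarith)).1
  linarith

lemma sq_le_two_of_bottom {a : ℝ} {A : Set Plane} (hA : IsSquareOfEdge 1 A)
    (h0 : !₂[0, 0] ∈ A) (h1 : !₂[a, 0] ∈ A) : a ^ 2 ≤ 2 := by
  have := hA.dist_sq_le_two h0 h1
  linarith

/-- Two of the three squares cannot contain opposite edges. -/
lemma not_opposite_edges {a : ℝ} (ha : sqrtPhi ≤ a) {A B C : Set Plane}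
    (hA : IsSquareOfEdge 1 A) (hB : IsSquareOfEdge 1 B) (hC : IsSquareOfEdge 1 C)
    (hcov : ∀ z ∈ frontier (stdSquare a), z ∈ A ∨ z ∈ B ∨ z ∈ C)
    (h00 : !₂[0, 0] ∈ A) (h10 : !₂[a, 0] ∈ A) (h01 : !₂[0, a] ∈ B) (h11 : !₂[a, a] ∈ B) :
    False := by
  have hr := lt_sqrtPhi
  have ha2 := sq_le_two_of_bottom hA h00 h10
  have haub : a < 1.415 := by nlinarith
  -- On the sides A stays below a - 1 < 0.45 and B above 1, so C holds both chords; but their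
  -- distance 0.45 exceeds a - 1.
  have key : ∀ y, 0.45 ≤ y → y ≤ 0.9 → !₂[0, y] ∈ C ∧ !₂[a, y] ∈ C := by
    intro y hy hy'
    have hA' : ¬ (!₂[0, y] ∈ A ∨ !₂[a, y] ∈ A) := fun h => by
      have := (abs_le.1 (hA.base_heights ha h00 h10 h)).2
      linarith
    have hB' : ¬ (!₂[0, y] ∈ B ∨ !₂[a, y] ∈ B) := fun h => by
      have := (abs_le.1 (hB.base_heights ha h01 h11 h)).1
      linarith
    have := edges_covered (by linarith) hcov (by linarith : 0 ≤ y) (by linarith)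
    tauto
  have k1 := key 0.45 (by norm_num) (by norm_num)
  have k2 := key 0.9 (by norm_num) (by norm_num)
  have := (abs_le.1 (hC.base_heights ha k1.1 k1.2 (Or.inl k2.1))).2
  linarith

/-- Consecutive squares along the three other edges of `[0, a]²` meet on these edges. -/
lemma exists_meeting_points {a : ℝ} (ha : sqrtPhi ≤ a) {A B C : Set Plane}
    (hA : IsSquareOfEdge 1 A) (hB : IsSquareOfEdge 1 B) (hC : IsSquareOfEdge 1 C)
    (hcov : ∀ z ∈ frontier (stdSquare a), z ∈ A ∨ z ∈ B ∨ z ∈ C)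
    (h00 : !₂[0, 0] ∈ A) (h10 : !₂[a, 0] ∈ A) (h01 : !₂[0, a] ∈ B) (h11 : !₂[a, a] ∈ C) :
    ∃ l t p, 0 ≤ l ∧ (!₂[0, l] ∈ A ∧ !₂[0, l] ∈ B) ∧ (!₂[a, t] ∈ A ∧ !₂[a, t] ∈ C) ∧
      (!₂[p, a] ∈ B ∧ !₂[p, a] ∈ C) := by
  have hr := lt_sqrtPhi
  have hr0 := sqrtPhi_pos
  have ha2 := sq_le_two_of_bottom hA h00 h10
  have haub : a < 1.415 := by nlinarith
  have ha0 : 0 ≤ a := by linarith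
  have clA := isClosed_of_isSquareOfEdge hA
  have clB := isClosed_of_isSquareOfEdge hB
  have clC := isClosed_of_isSquareOfEdge hC
  -- The height a - 0.9 lies above the reach a - 1 of A, yet is more than √2 from the opposite top
  -- corner: 1.272² + 0.9² > 2.
  have far : ∀ y, y ≤ a - 0.9 → !₂[0, y] ∉ C ∧ !₂[a, y] ∉ B := by
    intro y hy
    have e1 : 1.272 ^ 2 ≤ a ^ 2 := pow_le_pow_left₀ (by norm_num) (by linarith) 2
    have e2 : 0.9 ^ 2 ≤ (a - y) ^ 2 := pow_le_pow_left₀ (by norm_num) (by linarith) 2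
    constructor <;> intro h
    · linarith [hC.dist_sq_le_two h11 h]
    · linarith [hB.dist_sq_le_two h01 h]
  have hm : ¬ (!₂[0, a - 0.9] ∈ A ∨ !₂[a, a - 0.9] ∈ A) := fun h => by
    have := (abs_le.1 (hA.base_heights ha h00 h10 h)).2
    linarith
  have hm0 : 0 ≤ a - 0.9 := by linarith
  have hleft : ∀ y, 0 ≤ y → y ≤ a - 0.9 → !₂[0, y] ∈ A ∨ !₂[0, y] ∈ B := fun y h h' =>
    (edges_covered ha0 hcov h (by linarith)).1.imp_right fun h => h.resolve_right (far y h').1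
  have hright : ∀ y, 0 ≤ y → y ≤ a - 0.9 → !₂[a, y] ∈ A ∨ !₂[a, y] ∈ C := fun y h h' =>
    (edges_covered ha0 hcov h (by linarith)).2.1.imp_right fun h => h.resolve_left (far y h').2
  obtain ⟨l, hl0, -, hlA, hlB⟩ := exists_mem_inter clA clB (γ := fun y => !₂[0, y])
    (by fun_prop) hm0 h00
    ((hleft _ hm0 le_rfl).resolve_left fun h => hm (Or.inl h)) hleft
  obtain ⟨t, -, -, htA, htC⟩ := exists_mem_inter clA clC (γ := fun y => !₂[a, y])
    (by fun_prop) hm0 h10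
    ((hright _ hm0 le_rfl).resolve_left fun h => hm (Or.inr h)) hright
  obtain ⟨p, -, -, hpB, hpC⟩ := exists_mem_inter clB clC (γ := fun y => !₂[y, a])
    (by fun_prop) ha0 h01 h11
    fun y h h' => (edges_covered ha0 hcov h h').2.2.2.resolve_left
      (not_mem_top_of_bottom ha hA h00 h10 y)
  exact ⟨l, t, p, hl0, ⟨hlA, hlB⟩, ⟨htA, htC⟩, hpB, hpC⟩

lemma three_squares_aux {a c s e f : ℝ} (ha : sqrtPhi ≤ a) (hc : 0 ≤ c) (hs : 0 ≤ s)
    (hcs : c ^ 2 + s ^ 2 = 1) (hle : c ≤ s) {B C : Set Plane}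
    (hA : IsSquareOfEdge 1 (tiltedSquare c s e f))
    (hB : IsSquareOfEdge 1 B) (hC : IsSquareOfEdge 1 C)
    (hcov : ∀ z ∈ frontier (stdSquare a), z ∈ tiltedSquare c s e f ∨ z ∈ B ∨ z ∈ C)
    (h00 : !₂[0, 0] ∈ tiltedSquare c s e f) (h10 : !₂[a, 0] ∈ tiltedSquare c s e f)
    (h01 : !₂[0, a] ∈ B) (h11 : !₂[a, a] ∈ C) :
    a = sqrtPhi ∧ tiltedSquare c s e f = extremalSquares 0 ∧ B = extremalSquares 1 ∧
      C = extremalSquares 2 := by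
  obtain ⟨l, t, p, hl0, ⟨hlA, hlB⟩, ⟨htA, htC⟩, hpB, hpC⟩ :=
    exists_meeting_points ha hA hB hC hcov h00 h10 h01 h11
  obtain ⟨c₁, s₁, e₁, f₁, hc₁, hs₁, hcs₁, rfl⟩ := hB.exists_tiltedSquare
  obtain ⟨c₂, s₂, e₂, f₂, hc₂, hs₂, hcs₂, rfl⟩ := hC.exists_tiltedSquare
  rw [mem_tiltedSquare] at h00 h10 h01 h11 hlA hlB htA htC hpB hpC
  clear hcov hA hB hC
  -- The width inequalities survive replacing a by √φ; a is kept only in the top leg a - p, so that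
  -- the legs add up to a.
  have x1 := mul_le_mul_of_nonneg_right ha hs
  have x2 := mul_le_mul_of_nonneg_right ha hc
  have x3 := mul_le_mul_of_nonneg_right ha hs₁
  have x4 := mul_le_mul_of_nonneg_right ha hc₁
  have x5 := mul_le_mul_of_nonneg_right ha hs₂
  have x6 := mul_le_mul_of_nonneg_right ha hc₂
  have hcs₂' : s₂ ^ 2 + c₂ ^ 2 = 1 := by linarith
  have a1 : sqrtPhi * s + l * c ≤ 1 := by linarith
  have a2 : sqrtPhi * c + t * s ≤ 1 := by linarith
  have b1 : (sqrtPhi - l) * c₁ ≤ 1 := by linarith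
  have b2 : p * s₁ ≤ 1 := by linarith
  have b3 : (sqrtPhi - l) * s₁ + p * c₁ ≤ 1 := by linarith
  have d1 : (sqrtPhi - t) * s₂ ≤ 1 := by linarith
  have d2 : (a - p) * c₂ ≤ 1 := by linarith
  have d3 : (sqrtPhi - t) * c₂ + (a - p) * s₂ ≤ 1 := by linarith
  -- c₂ and s₂ are exchanged because C sits at the mirror-image corner.
  have hsum := (extremal_inequality hc hs hcs hc₁ hs₁ hcs₁ hs₂ hc₂ hcs₂' hle hl0 a1 a2 b1 b2 b3
    d1 d2 d3).1
  obtain rfl : a = sqrtPhi := by linarith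
  obtain ⟨rfl, rfl, rfl, ⟨rfl, rfl⟩, ⟨rfl, rfl⟩, h2⟩ := extremal_rigidity hc hs hcs hc₁ hs₁ hcs₁
    hs₂ hc₂ hcs₂' hle hl0 a1 a2 b1 b2 b3 d1 d2 d3 (by ring)
  have hr0 := sqrtPhi_pos
  have hk : 1 / sqrtPhi * sqrtPhi = 1 := by field_simp
  have hk' : 1 / sqrtPhi ^ 2 * sqrtPhi = 1 / sqrtPhi := by field_simp
  refine ⟨rfl, ?_, ?_, ?_⟩
  · rw [extremalSquares_zero]
    congr 1 <;> linarith
  · rw [extremalSquares_one]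
    congr 1 <;> linarith
  · ext z
    rw [mem_extremalSquares_two]
    simp only [tiltedSquare, Set.mem_ofPred_eq, Set.mem_Icc]
    rcases h2 with ⟨rfl, rfl⟩ | ⟨rfl, rfl⟩
    · have he : e₂ = sqrtPhi - 1 := by linarith
      have hf : f₂ = sqrtPhi - 1 := by linarith
      rw [he, hf]
      constructor <;> rintro ⟨⟨_, _⟩, _, _⟩ <;> refine ⟨⟨?_, ?_⟩, ?_, ?_⟩ <;> linarith
    · have he : e₂ = sqrtPhi - 1 := by linarith
      have hf : f₂ = -sqrtPhi := by linarith
      rw [he, hf]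
      constructor <;> rintro ⟨⟨_, _⟩, _, _⟩ <;> refine ⟨⟨?_, ?_⟩, ?_, ?_⟩ <;> linarith

lemma frontier_cover_image_three {a : ℝ} {A B C : Set Plane} (ρ : Plane ≃ᵢ Plane)
    (hρ : ρ '' stdSquare a = stdSquare a)
    (hcov : ∀ z ∈ frontier (stdSquare a), z ∈ A ∨ z ∈ B ∨ z ∈ C) :
    ∀ z ∈ frontier (stdSquare a), z ∈ ρ '' A ∨ z ∈ ρ '' B ∨ z ∈ ρ '' C := by
  intro z hz
  rw [← hρ, ← ρ.image_frontier] at hz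
  obtain ⟨w, hw, rfl⟩ := hz
  exact (hcov w hw).imp (Set.mem_image_of_mem _)
    (Or.imp (Set.mem_image_of_mem _) (Set.mem_image_of_mem _))

lemma image_refl (S : Set Plane) : IsometryEquiv.refl Plane '' S = S := Set.image_id S

/-- The reflection exchanges c with s and B with C, so c ≤ s may be assumed. -/
lemma three_squares_of_corners {a : ℝ} (ha : sqrtPhi ≤ a) {A B C : Set Plane}
    (hA : IsSquareOfEdge 1 A) (hB : IsSquareOfEdge 1 B) (hC : IsSquareOfEdge 1 C)
    (hcov : ∀ z ∈ frontier (stdSquare a), z ∈ A ∨ z ∈ B ∨ z ∈ C)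
    (h00 : !₂[0, 0] ∈ A) (h10 : !₂[a, 0] ∈ A) (h01 : !₂[0, a] ∈ B) (h11 : !₂[a, a] ∈ C) :
    a = sqrtPhi ∧ ∃ g : Plane ≃ᵢ Plane, g '' stdSquare a = stdSquare a ∧
      g '' A = extremalSquares 0 ∧ (g '' B = extremalSquares 1 ∧ g '' C = extremalSquares 2 ∨
        g '' C = extremalSquares 1 ∧ g '' B = extremalSquares 2) := by
  obtain ⟨c, s, e, f, hc, hs, hcs, rfl⟩ := hA.exists_tiltedSquare
  rcases le_total c s with hle | hle
  · obtain ⟨h1, h2, h3, h4⟩ := three_squares_aux ha hc hs hcs hle hA hB hC hcov h00 h10 h01 h11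
    exact ⟨h1, IsometryEquiv.refl _, image_refl _, (image_refl _).trans h2,
      Or.inl ⟨(image_refl _).trans h3, (image_refl _).trans h4⟩⟩
  · have hcov' := frontier_cover_image_three (mirror a) (mirror_image_stdSquare a) hcov
    have hA' := hA.image (mirror a)
    have h00' : !₂[0, 0] ∈ mirror a '' tiltedSquare c s e f := by
      rw [mem_image_mirror]; simpa using h10
    have h10' : !₂[a, 0] ∈ mirror a '' tiltedSquare c s e f := by
      rw [mem_image_mirror]; simpa using h00
    have hAm := mirror_image_tiltedSquare a c s e f
    rw [hAm] at hA' hcov' h00' h10'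
    obtain ⟨h1, h2, h3, h4⟩ := three_squares_aux ha hs hc (by linarith) hle hA'
      (hC.image (mirror a)) (hB.image (mirror a)) (fun z hz => by have := hcov' z hz; tauto)
      h00' h10' (by rw [mem_image_mirror]; simpa using h11)
      (by rw [mem_image_mirror]; simpa using h01)
    exact ⟨h1, mirror a, mirror_image_stdSquare a, hAm.trans h2, Or.inr ⟨h3, h4⟩⟩

/-- `F` is, up to a symmetry of `[0, a]²` and the order, the extremal family, and `a = √φ`. -/
def IsExtremal (a : ℝ) (F : Fin 3 → Set Plane) : Prop :=
  a = sqrtPhi ∧ ∃ (g : Plane ≃ᵢ Plane) (σ : Equiv.Perm (Fin 3)),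
    g '' stdSquare a = stdSquare a ∧ ∀ i, g '' F (σ i) = extremalSquares i

lemma IsExtremal.of_image {a : ℝ} {F : Fin 3 → Set Plane} (ρ : Plane ≃ᵢ Plane)
    (hρ : ρ '' stdSquare a = stdSquare a) (h : IsExtremal a fun i => ρ '' F i) :
    IsExtremal a F := by
  obtain ⟨h1, g, σ, h2, h3⟩ := h
  have hc : ∀ S : Set Plane, (ρ.trans g) '' S = g '' (ρ '' S) := fun S => by
    rw [Set.image_image]; rfl
  exact ⟨h1, ρ.trans g, σ, by rw [hc, hρ, h2], fun i => by rw [hc, h3]⟩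

/-- `F` is a family of unit squares covering the boundary of `[0, a]²`. -/
def CoversBoundary (a : ℝ) (F : Fin 3 → Set Plane) : Prop :=
  (∀ i, IsSquareOfEdge 1 (F i)) ∧ frontier (stdSquare a) ⊆ ⋃ i, F i

lemma CoversBoundary.quarterTurn {a : ℝ} {F : Fin 3 → Set Plane} (h : CoversBoundary a F) :
    CoversBoundary a fun i => quarterTurn a '' F i :=
  ⟨fun i => (h.1 i).image _, frontier_cover_image _ (quarterTurn_image_stdSquare a) h.2⟩

lemma isExtremal_of_bottom {a : ℝ} (ha : sqrtPhi ≤ a) {F : Fin 3 → Set Plane}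
    (hF : CoversBoundary a F) (i : Fin 3) (h00 : !₂[0, 0] ∈ F i) (h10 : !₂[a, 0] ∈ F i) :
    IsExtremal a F := by
  have hr := lt_sqrtPhi
  have ha0 : 0 ≤ a := by linarith
  have hcov : ∀ j k, i ≠ j → i ≠ k → j ≠ k →
      ∀ z ∈ frontier (stdSquare a), z ∈ F i ∨ z ∈ F j ∨ z ∈ F k := by
    intro j k h1 h2 h3 z hz
    obtain ⟨m, hm⟩ := Set.mem_iUnion.1 (hF.2 hz)
    have : m = i ∨ m = j ∨ m = k := by omega
    rcases this with rfl | rfl | rfl <;> simp [hm]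
  have hperm : ∀ j k, i ≠ j → i ≠ k → j ≠ k →
      ∃ σ : Equiv.Perm (Fin 3), σ 0 = i ∧ σ 1 = j ∧ σ 2 = k := by
    clear * -
    revert i; decide
  have key : ∀ j k, i ≠ j → i ≠ k → j ≠ k → !₂[0, a] ∈ F j → !₂[a, a] ∈ F k →
      IsExtremal a F := by
    intro j k h1 h2 h3 h01 h11
    obtain ⟨e, g, g1, g2, g3⟩ := three_squares_of_corners ha (hF.1 i) (hF.1 j) (hF.1 k)
      (hcov j k h1 h2 h3) h00 h10 h01 h11
    rcases g3 with g3 | g3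
    · obtain ⟨σ, rfl, rfl, rfl⟩ := hperm j k h1 h2 h3
      refine ⟨e, g, σ, g1, fun m => ?_⟩
      fin_cases m
      exacts [g2, g3.1, g3.2]
    · obtain ⟨σ, rfl, rfl, rfl⟩ := hperm k j h2 h1 h3.symm
      refine ⟨e, g, σ, g1, fun m => ?_⟩
      fin_cases m
      exacts [g2, g3.1, g3.2]
  have hv := fun {y : ℝ} (h : 0 ≤ y) (h' : y ≤ a) =>
    edges_covered ha0 (P := fun z => ∃ i, z ∈ F i) (fun z hz => Set.mem_iUnion.1 (hF.2 hz)) h h'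
  obtain ⟨j, hj⟩ := (hv ha0 le_rfl).1
  obtain ⟨k, hk⟩ := (hv ha0 le_rfl).2.1
  have nij : i ≠ j := by
    rintro rfl; exact not_mem_top_of_bottom ha (hF.1 i) h00 h10 _ hj
  have nik : i ≠ k := by
    rintro rfl; exact not_mem_top_of_bottom ha (hF.1 i) h00 h10 _ hk
  by_cases hjk : j = k
  · subst hjk
    obtain ⟨m, m1, m2⟩ : ∃ m, i ≠ m ∧ j ≠ m := by
      clear * -
      revert i j; decide
    exact (not_opposite_edges ha (hF.1 i) (hF.1 j) (hF.1 m) (hcov j m nij m1 m2)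
      h00 h10 hj hk).elim
  · exact key j k nij nik hjk hj hk

/-- The quarter turn carries the left edge to the bottom, the top to the left and the right to the
top. -/
lemma isExtremal_of_left {a : ℝ} (ha : sqrtPhi ≤ a) {F : Fin 3 → Set Plane}
    (hF : CoversBoundary a F) (i : Fin 3) (h1 : !₂[0, a] ∈ F i) (h2 : !₂[0, 0] ∈ F i) :
    IsExtremal a F :=
  (isExtremal_of_bottom ha hF.quarterTurn i (by rw [mem_image_quarterTurn]; simpa using h1)
    (by rw [mem_image_quarterTurn]; simpa using h2)).of_image _ (quarterTurn_image_stdSquare a)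

lemma isExtremal_of_top {a : ℝ} (ha : sqrtPhi ≤ a) {F : Fin 3 → Set Plane}
    (hF : CoversBoundary a F) (i : Fin 3) (h1 : !₂[a, a] ∈ F i) (h2 : !₂[0, a] ∈ F i) :
    IsExtremal a F :=
  (isExtremal_of_left ha hF.quarterTurn i (by rw [mem_image_quarterTurn]; simpa using h1)
    (by rw [mem_image_quarterTurn]; simpa using h2)).of_image _ (quarterTurn_image_stdSquare a)

lemma isExtremal_of_right {a : ℝ} (ha : sqrtPhi ≤ a) {F : Fin 3 → Set Plane}
    (hF : CoversBoundary a F) (i : Fin 3) (h1 : !₂[a, 0] ∈ F i) (h2 : !₂[a, a] ∈ F i) :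
    IsExtremal a F :=
  (isExtremal_of_top ha hF.quarterTurn i (by rw [mem_image_quarterTurn]; simpa using h1)
    (by rw [mem_image_quarterTurn]; simpa using h2)).of_image _ (quarterTurn_image_stdSquare a)

lemma CoversBoundary.isExtremal {a : ℝ} (ha : sqrtPhi ≤ a) {F : Fin 3 → Set Plane}
    (hF : CoversBoundary a F) : IsExtremal a F := by
  have hr := lt_sqrtPhi
  have ha0 : 0 ≤ a := by linarith
  have hv := fun {y : ℝ} (h : 0 ≤ y) (h' : y ≤ a) =>
    edges_covered ha0 (P := fun z => ∃ i, z ∈ F i) (fun z hz => Set.mem_iUnion.1 (hF.2 hz)) h h'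
  obtain ⟨i00, h00⟩ := (hv le_rfl ha0).1
  obtain ⟨i10, h10⟩ := (hv le_rfl ha0).2.1
  obtain ⟨i01, h01⟩ := (hv ha0 le_rfl).1
  obtain ⟨i11, h11⟩ := (hv ha0 le_rfl).2.1
  have n1 : i00 ≠ i11 := by
    rintro rfl; have := (hF.1 i00).dist_sq_le_two h00 h11; nlinarith
  have n2 : i10 ≠ i01 := by
    rintro rfl; have := (hF.1 i10).dist_sq_le_two h10 h01; nlinarith
  -- Pigeonhole: four corners, three squares, no shared diagonal.
  have : i00 = i10 ∨ i01 = i00 ∨ i11 = i01 ∨ i10 = i11 := by omega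
  rcases this with rfl | rfl | rfl | rfl
  · exact isExtremal_of_bottom ha hF _ h00 h10
  · exact isExtremal_of_left ha hF _ h01 h00
  · exact isExtremal_of_top ha hF _ h11 h01
  · exact isExtremal_of_right ha hF _ h10 h11

/-! ### Arbitrary position -/

lemma IsSquareOfEdge.normalize {n : ℕ} {a : ℝ} {S : Set Plane} {F : Fin n → Set Plane}
    (hS : IsSquareOfEdge a S) (hF : ∀ i, IsSquareOfEdge 1 (F i)) (hcov : frontier S ⊆ ⋃ i, F i) :
    ∃ g : Plane ≃ᵢ Plane, g '' S = stdSquare a ∧ (∀ i, IsSquareOfEdge 1 (g '' F i)) ∧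
      frontier (stdSquare a) ⊆ ⋃ i, g '' F i := by
  obtain ⟨-, k, rfl⟩ := hS
  have h : k.symm '' (k '' stdSquare a) = stdSquare a := by simp [Set.image_image]
  refine ⟨k.symm, h, fun i => (hF i).image _, ?_⟩
  rw [← h, ← k.symm.image_frontier, ← Set.image_iUnion]
  exact Set.image_mono hcov

lemma coverableEdges_subset (n : ℕ) : coverableEdges n ⊆ bdCoverableEdges n := by
  rintro a ⟨S, F, hS, hF, h⟩
  exact ⟨S, F, hS, hF, (isClosed_of_isSquareOfEdge hS).frontier_subset.trans h⟩

lemma isSquareOfEdge_stdSquare {a : ℝ} (ha : 0 < a) : IsSquareOfEdge a (stdSquare a) :=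
  ⟨ha, IsometryEquiv.refl _, (image_refl _).symm⟩

/-- A solid construction and a boundary upper bound together settle both maxima. -/
lemma isSbd_and_isS {n : ℕ} {s : ℝ} (h : s ∈ coverableEdges n)
    (h' : s ∈ upperBounds (bdCoverableEdges n)) : IsSbd n s ∧ IsS n s :=
  ⟨⟨coverableEdges_subset n h, h'⟩, h, fun _ ha => h' (coverableEdges_subset n ha)⟩

theorem theorem1 :
    (IsSbd 2 1 ∧ IsS 2 1) ∧
    (IsSbd 3 sqrtPhi ∧ IsS 3 sqrtPhi) ∧
    (∀ (S : Set Plane) (F : Fin 2 → Set Plane),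
      IsSquareOfEdge 1 S → (∀ i, IsSquareOfEdge 1 (F i)) → frontier S ⊆ ⋃ i, F i →
        ∃ (i : Fin 2) (v : Plane), F i = (fun x => x + v) '' S) ∧
    (∀ (S : Set Plane) (F : Fin 3 → Set Plane),
      IsSquareOfEdge sqrtPhi S → (∀ i, IsSquareOfEdge 1 (F i)) → frontier S ⊆ ⋃ i, F i →
        ∃ (g : Plane ≃ᵢ Plane) (σ : Equiv.Perm (Fin 3)),
          g '' S = stdSquare sqrtPhi ∧ ∀ i, g '' F (σ i) = extremalSquares i) := by
  refine ⟨isSbd_and_isS ?_ ?_, isSbd_and_isS ?_ ?_, ?_, ?_⟩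
  · exact ⟨stdSquare 1, fun _ => stdSquare 1, isSquareOfEdge_stdSquare one_pos,
      fun _ => isSquareOfEdge_stdSquare one_pos, Set.subset_iUnion (fun _ : Fin 2 => stdSquare 1) 0⟩
  · rintro a ⟨S, F, hS, hF, hcov⟩
    obtain ⟨g, -, hF', hcov'⟩ := hS.normalize hF hcov
    by_contra! h
    exact h.ne' (two_squares h.le hF' hcov').1
  · exact ⟨stdSquare sqrtPhi, extremalSquares, isSquareOfEdge_stdSquare sqrtPhi_pos,
      isSquareOfEdge_extremalSquares, stdSquare_sqrtPhi_subset⟩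
  · rintro a ⟨S, F, hS, hF, hcov⟩
    obtain ⟨g, -, hF', hcov'⟩ := hS.normalize hF hcov
    by_contra! h
    exact h.ne' (CoversBoundary.isExtremal h.le ⟨hF', hcov'⟩).1
  · intro S F hS hF hcov
    obtain ⟨g, hg, hF', hcov'⟩ := hS.normalize hF hcov
    obtain ⟨-, i, v, h⟩ := two_squares le_rfl hF' hcov'
    obtain ⟨w, hw⟩ := image_translate g.symm (stdSquare 1) v
    refine ⟨i, w, ?_⟩
    have hback : ∀ T : Set Plane, g.symm '' (g '' T) = T := fun T => by simp [Set.image_image]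
    rw [← hback (F i), h, hw, ← hg, hback]
  · intro S F hS hF hcov
    obtain ⟨g, hg, hF', hcov'⟩ := hS.normalize hF hcov
    obtain ⟨-, k, σ, hk, h⟩ := CoversBoundary.isExtremal le_rfl ⟨hF', hcov'⟩
    have hc : ∀ T : Set Plane, (g.trans k) '' T = k '' (g '' T) := fun T => by
      rw [Set.image_image]; rfl
    exact ⟨g.trans k, σ, by rw [hc, hg, hk], fun i => by rw [hc]; exact h i⟩
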